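/- Let $\Omega$ be a finite set, let $P\in\mathbb{R}^{\Omega\times\Omega}$ be the transition matrix of a Markov chain on $\Omega$ that is reversible with respect to a probability distribution $\pi$ on $\Omega$, i.e. $\pi(x)P(x,y)=\pi(y)P(y,x)$ for all $x,y\in\Omega$. Let $d\in\mathbb{N}$ and let $\mathbb{S}_d$ be the space of real symmetric $d\times d$ matrices. For $f:\Omega\to\mathbb{S}_d$ put $$\mathbb{E}_\pi[f]=\sum_{x\in\Omega}\pi(x)f(x),\qquad \mathbf{Var}_\pi[f]=\mathbb{E}_\pi[f^2]-(\mathbb{E}_\pi[f])^2,\qquad \mathcal{E}_P[f,f]=\sum_{x,y\in\Omega}\pi(x)P(x,y)\,(f(x)-f(y))^2 .$$ Suppose that the chain satisfies the matrix-valued Poincaré inequality with constant $\lambda>0$, i.e. $\lambda\,\mathbf{Var}_\pi[f]\preceq\mathcal{E}_P[f,f]$ in the positive semidefinite (Loewner) order for every $f:\Omega\to\mathbb{S}_d$. Let $\mathbf{F}:\Omega\to\mathbb{S}_d$, and let $$v(\mathbf{F})=\max\{\|\mathbf{F}(x)-\mathbf{F}(y)\| : x,y\in\Omega,\ P(x,y)>0\},$$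 where $\|\cdot\|$ is the spectral norm. Then for every $t>0$, $$\Pr_{x\sim\pi}\big[\|\mathbf{F}(x)-\mathbb{E}_\pi[\mathbf{F}]\|\ge t\big]\le 2d\,\exp\!\left(-\frac{t^2}{4\big(v(\mathbf{F})^2/\lambda+t\,v(\mathbf{F})/\sqrt{\lambda}\big)}\right),$$ where for $v(\mathbf{F})=0$ the right-hand side is read as $0$ (that is, the probability is then $0$). -/

import Mathlib

open scoped Matrix.Norms.L2Operator

noncomputable section

namespace MatrixPoincare

/-- `P` is the transition matrix of a Markov chain on the finite state space `Ω` which is reversible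
(satisfies detailed balance) with respect to the probability distribution `p`.
Stationarity of `p` is a consequence of detailed balance. -/
structure IsReversible {Ω : Type*} [Fintype Ω] [DecidableEq Ω]
    (P : Matrix Ω Ω ℝ) (p : Ω → ℝ) : Prop where
  stochastic : P ∈ Matrix.rowStochastic ℝ Ω
  distribution : p ∈ stdSimplex ℝ Ω
  detailed_balance : ∀ x y, p x * P x y = p y * P y x

/-- The expectation `E_p[F] = ∑ x, p(x) F(x)` of a matrix-valued function. -/
def expect {Ω : Type*} [Fintype Ω] {d : ℕ} (p : Ω → ℝ)
    (F : Ω → Matrix (Fin d) (Fin d) ℝ) : Matrix (Fin d) (Fin d) ℝ :=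
  ∑ x, p x • F x

/-- The matrix variance `Var_p[F] = E_p[F²] - (E_p[F])²`. -/
def variance {Ω : Type*} [Fintype Ω] {d : ℕ} (p : Ω → ℝ)
    (F : Ω → Matrix (Fin d) (Fin d) ℝ) : Matrix (Fin d) (Fin d) ℝ :=
  expect p (fun x => F x ^ 2) - expect p F ^ 2

/-- The matrix Dirichlet form `E_P[F, F] = ∑ x, ∑ y, p(x) P(x,y) (F(x) - F(y))²`. -/
def dirichlet {Ω : Type*} [Fintype Ω] {d : ℕ} (P : Matrix Ω Ω ℝ) (p : Ω → ℝ)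
    (F : Ω → Matrix (Fin d) (Fin d) ℝ) : Matrix (Fin d) (Fin d) ℝ :=
  ∑ x, ∑ y, (p x * P x y) • (F x - F y) ^ 2

/-- The chain satisfies the matrix-valued Poincaré inequality with constant `lam` in dimension `d`:
`lam • Var_p[f] ≼ E_P[f, f]` in the Loewner order for every function `f` with values in the
symmetric `d × d` matrices. -/
def Poincare {Ω : Type*} [Fintype Ω] (d : ℕ) (P : Matrix Ω Ω ℝ) (p : Ω → ℝ) (lam : ℝ) : Prop :=
  ∀ f : Ω → Matrix (Fin d) (Fin d) ℝ, (∀ x, (f x).IsSymm) →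
    (dirichlet P p f - lam • variance p f).PosSemidef

/-- `v(F)`: the largest spectral norm `‖F(x) - F(y)‖` over the edges `x ∼ y` of the chain, that is,
over the pairs with `P(x,y) > 0` (self-loops contribute `0`). -/
def maxStep {Ω : Type*} {d : ℕ} (P : Matrix Ω Ω ℝ)
    (F : Ω → Matrix (Fin d) (Fin d) ℝ) : ℝ :=
  ⨆ e : {e : Ω × Ω // 0 < P e.1 e.2}, ‖F e.1.1 - F e.1.2‖

/-- The probability under `p` that `‖F(x) - E_p[F]‖ ≥ t`, with the spectral norm. -/
def deviationProb {Ω : Type*} [Fintype Ω] {d : ℕ} (p : Ω → ℝ)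
    (F : Ω → Matrix (Fin d) (Fin d) ℝ) (t : ℝ) : ℝ :=
  ∑ x with t ≤ ‖F x - expect p F‖, p x

end MatrixPoincare

end

/-! Only the trace of the Poincaré inequality is used, applied to hyperbolic sines of `F`. The
obstacle is the squared mean subtracted in the variance; it is removed by symmetrizing: `H x z =
sinh (c (F x - F z))` is antisymmetric, so its partial means average to zero, and a second use of
Poincaré absorbs them at the cost of a factor 2 (`Poincare.sum_trace_sq_le_of_antisymm`). The mean
value inequality `trace_sq_cfc_sub_le` bounds the Dirichlet form of `H` by `c² v²` times the mean of
`tr cosh²`. Since `cosh² = 1 + sinh²`, the mean `S` of `tr H²` satisfies `S ≤ s (d + S)` with `s = 2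
c² v² / lam`; for `s < 1` this bounds the mean of `tr cosh (2c (F x - F z)) = d + 2 tr H²`. Jensen
replaces `F z` by the mean of `F`, Markov's inequality gives the tail, and `c` is then chosen. -/

namespace Real

/-! ### Scalar inequalities for hyperbolic functions. -/

lemma sinh_le_mul_cosh {x : ℝ} (hx : 0 ≤ x) : sinh x ≤ x * cosh x := by
  have hmono : MonotoneOn (fun x : ℝ => x * cosh x - sinh x) (Set.Ici 0) := by
    refine monotoneOn_of_deriv_nonneg (convex_Ici 0) (by fun_prop) (by fun_prop) ?_
    intro y hy
    rw [interior_Ici] at hy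
    have hd : HasDerivAt (fun x : ℝ => x * cosh x - sinh x)
        (1 * cosh y + y * sinh y - cosh y) y :=
      ((hasDerivAt_id y).mul (hasDerivAt_cosh y)).sub (hasDerivAt_sinh y)
    rw [hd.deriv]
    have : 0 ≤ y * sinh y := mul_nonneg hy.le (sinh_nonneg_iff.2 hy.le)
    linarith
  have := hmono Set.self_mem_Ici hx hx
  simpa using this

lemma sinh_sq_le_mul_cosh_sq (x : ℝ) : sinh x ^ 2 ≤ x ^ 2 * cosh x ^ 2 := by
  have h := sinh_le_mul_cosh (abs_nonneg x)
  rw [cosh_abs] at h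
  have h0 : 0 ≤ sinh |x| := sinh_nonneg_iff.2 (abs_nonneg x)
  have h1 := pow_le_pow_left₀ h0 h 2
  rw [mul_pow, sq_abs] at h1
  rcases abs_choice x with hx | hx <;> rw [hx] at h1 <;> simpa using h1

/-- In terms of the midpoint `w` and half-difference `u`, the left side is `4 cosh² w sinh² u`, and
`sinh² u ≤ u² cosh² u` suffices. The right side separates `a` from `b`, as the passage to traces
requires. -/
lemma sinh_sub_sinh_sq_le (a b : ℝ) :
    (sinh a - sinh b) ^ 2 ≤ (a - b) ^ 2 * (cosh a ^ 2 / 2 + cosh b ^ 2 / 2) := by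
  obtain ⟨u, w, rfl, rfl⟩ : ∃ u w : ℝ, a = w + u ∧ b = w - u :=
    ⟨(a - b) / 2, (a + b) / 2, by ring, by ring⟩
  have hu := sinh_sq_le_mul_cosh_sq u
  have hcu := cosh_sq u
  have hcw := cosh_sq w
  rw [sinh_add, sinh_sub, cosh_add, cosh_sub]
  have e1 : (sinh w * cosh u + cosh w * sinh u - (sinh w * cosh u - cosh w * sinh u)) ^ 2
      = 4 * cosh w ^ 2 * sinh u ^ 2 := by ring
  have e2 : (w + u - (w - u)) ^ 2 * ((cosh w * cosh u + sinh w * sinh u) ^ 2 / 2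
      + (cosh w * cosh u - sinh w * sinh u) ^ 2 / 2)
      = 4 * cosh w ^ 2 * (u ^ 2 * cosh u ^ 2) + 4 * u ^ 2 * sinh w ^ 2 * sinh u ^ 2 := by ring
  rw [e1, e2]
  have h1 := mul_le_mul_of_nonneg_left hu (by positivity : 0 ≤ 4 * cosh w ^ 2)
  have h2 : 0 ≤ 4 * u ^ 2 * sinh w ^ 2 * sinh u ^ 2 := by positivity
  linarith

lemma convexOn_cosh : ConvexOn ℝ Set.univ cosh := by
  have h : cosh = fun x => (2⁻¹ : ℝ) • (exp x + exp (-x)) := by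
    ext x; rw [cosh_eq, smul_eq_mul]; ring
  rw [h]
  refine ConvexOn.smul (by norm_num) (convexOn_exp.add ?_)
  exact convexOn_exp.comp_linearMap (-LinearMap.id : ℝ →ₗ[ℝ] ℝ)

end Real

/-! ### Trace inequalities for functions of symmetric matrices. -/

namespace Matrix

variable {n : Type*} [Fintype n]

lemma trace_transpose_mul_self_eq_sum (M : Matrix n n ℝ) :
    (Mᵀ * M).trace = ∑ i, ∑ j, M i j ^ 2 := by
  simp only [trace, diag, mul_apply, transpose_apply]
  rw [Finset.sum_comm]
  simp [pow_two]

variable [DecidableEq n]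

lemma cfc_id_of_isHermitian {A : Matrix n n ℝ} (hA : A.IsHermitian) :
    cfc (id : ℝ → ℝ) A = A :=
  cfc_id ℝ A hA

lemma IsHermitian.exists_cfc_eq_conj {A : Matrix n n ℝ} (hA : A.IsHermitian) :
    ∃ (U : Matrix n n ℝ) (a : n → ℝ), Uᵀ * U = 1 ∧ U * Uᵀ = 1 ∧
      ∀ φ : ℝ → ℝ, cfc φ A = U * diagonal (fun i => φ (a i)) * Uᵀ := by
  refine ⟨hA.eigenvectorUnitary, hA.eigenvalues, ?_, ?_, fun φ => ?_⟩
  · simpa [star_eq_conjTranspose] using Unitary.coe_star_mul_self hA.eigenvectorUnitary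
  · simpa [star_eq_conjTranspose] using Unitary.coe_mul_star_self hA.eigenvectorUnitary
  · rw [hA.cfc_eq, IsHermitian.cfc, Unitary.conjStarAlgAut_apply]
    simp [star_eq_conjTranspose, Function.comp_def]

lemma sum_sq_apply_le_norm_sq (M : Matrix n n ℝ) (j : n) : ∑ i, M i j ^ 2 ≤ ‖M‖ ^ 2 := by
  have h := l2_opNorm_mulVec M (EuclideanSpace.single j 1)
  have h2 := pow_le_pow_left₀ (norm_nonneg _) h 2
  rw [EuclideanSpace.norm_sq_eq] at h2
  simpa using h2

lemma norm_conj_le (U V M : Matrix n n ℝ) (hU : Uᵀ * U = 1) (hV : Vᵀ * V = 1) :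
    ‖Uᵀ * M * V‖ ≤ ‖M‖ := by
  have key : ∀ W : Matrix n n ℝ, Wᵀ * W = 1 → ‖W‖ ≤ 1 := by
    intro W hW
    have h := l2_opNorm_conjTranspose_mul_self W
    rw [conjTranspose_eq_transpose_of_trivial, hW] at h
    have h1 : ‖(1 : Matrix n n ℝ)‖ ≤ 1 := by
      rw [← diagonal_one, l2_opNorm_diagonal]
      exact (pi_norm_le_iff_of_nonneg zero_le_one).2 fun i => by simp
    nlinarith [norm_nonneg W]
  have hU' : ‖Uᵀ‖ ≤ 1 := by
    rw [← conjTranspose_eq_transpose_of_trivial, l2_opNorm_conjTranspose]; exact key U hU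
  calc ‖Uᵀ * M * V‖ ≤ ‖Uᵀ‖ * ‖M‖ * ‖V‖ :=
        (norm_mul_le _ _).trans (mul_le_mul_of_nonneg_right (norm_mul_le _ _) (norm_nonneg _))
    _ ≤ 1 * ‖M‖ * 1 := by gcongr; exact key V hV
    _ = ‖M‖ := by ring

lemma trace_cfc_of_eq_conj {A U : Matrix n n ℝ} {a : n → ℝ} {φ : ℝ → ℝ} (hU : Uᵀ * U = 1)
    (h : cfc φ A = U * diagonal (fun i => φ (a i)) * Uᵀ) : (cfc φ A).trace = ∑ i, φ (a i) := by
  rw [h, trace_mul_comm, ← Matrix.mul_assoc, hU, Matrix.one_mul, trace_diagonal]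

lemma isHermitian_cfc (φ : ℝ → ℝ) (A : Matrix n n ℝ) : (cfc φ A).IsHermitian :=
  (cfc_predicate φ A : IsSelfAdjoint (cfc φ A))

lemma continuousOn_spectrum (φ : ℝ → ℝ) (A : Matrix n n ℝ) : ContinuousOn φ (spectrum ℝ A) :=
  (finite_real_spectrum (A := A)).continuousOn φ

lemma cfc_neg_of_odd {φ : ℝ → ℝ} (hφ : ∀ a, φ (-a) = -φ a) {A : Matrix n n ℝ}
    (hA : A.IsHermitian) : cfc φ (-A) = -cfc φ A := by
  have h := cfc_comp_neg φ A (((finite_real_spectrum (A := A)).image _).continuousOn φ) hA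
  have h2 := cfc_neg φ A
  simp only [hφ] at h
  exact h.symm.trans h2

/-- A mean value inequality for trace functions. -/
lemma trace_sq_cfc_sub_le {A B : Matrix n n ℝ} (hA : A.IsHermitian) (hB : B.IsHermitian)
    (φ ψ : ℝ → ℝ) (h : ∀ a b, (φ a - φ b) ^ 2 ≤ (a - b) ^ 2 * (ψ a + ψ b)) (hψ : ∀ a, 0 ≤ ψ a) :
    ((cfc φ A - cfc φ B) ^ 2).trace ≤ ‖A - B‖ ^ 2 * ((cfc ψ A).trace + (cfc ψ B).trace) := by
  obtain ⟨U, a, hU, hU', hUA⟩ := hA.exists_cfc_eq_conj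
  obtain ⟨V, b, hV, hV', hVB⟩ := hB.exists_cfc_eq_conj
  -- `A` and `B` need not commute: rows are taken in an eigenbasis of `A` and columns in one of `B`,
  -- which reduces the claim to the scalar hypothesis entry by entry.
  have entry : ∀ (χ : ℝ → ℝ) i j, (Uᵀ * (cfc χ A - cfc χ B) * V) i j
      = (χ (a i) - χ (b j)) * (Uᵀ * V) i j := by
    intro χ i j
    have : Uᵀ * (cfc χ A - cfc χ B) * V
        = diagonal (fun i => χ (a i)) * (Uᵀ * V) - (Uᵀ * V) * diagonal (fun j => χ (b j)) := by
      rw [hUA, hVB, Matrix.mul_sub, Matrix.sub_mul]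
      congr 1
      · rw [← Matrix.mul_assoc, ← Matrix.mul_assoc, hU, Matrix.one_mul, Matrix.mul_assoc]
      · rw [← Matrix.mul_assoc, Matrix.mul_assoc _ Vᵀ V, hV, Matrix.mul_one, Matrix.mul_assoc]
    rw [this, sub_apply, diagonal_mul, mul_diagonal]
    ring
  have frob : ((cfc φ A - cfc φ B) ^ 2).trace
      = ∑ i, ∑ j, ((Uᵀ * (cfc φ A - cfc φ B) * V) i j) ^ 2 := by
    rw [← trace_transpose_mul_self_eq_sum]
    have hs : (cfc φ A - cfc φ B)ᵀ = cfc φ A - cfc φ B := by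
      rw [← conjTranspose_eq_transpose_of_trivial]
      exact (isHermitian_cfc φ A).sub (isHermitian_cfc φ B)
    set M := cfc φ A - cfc φ B
    have e : (Uᵀ * M * V)ᵀ * (Uᵀ * M * V) = Vᵀ * (M ^ 2 * V) := by
      rw [transpose_mul, transpose_mul, transpose_transpose, hs]
      calc Vᵀ * (M * U) * (Uᵀ * M * V) = Vᵀ * (M * (U * Uᵀ) * (M * V)) := by
            simp only [Matrix.mul_assoc]
        _ = _ := by rw [hU', Matrix.mul_one, pow_two, Matrix.mul_assoc]
    rw [e, trace_mul_comm, Matrix.mul_assoc, hV', Matrix.mul_one]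
  set D := Uᵀ * (A - B) * V with hD
  have hDe : ∀ i j, D i j = (a i - b j) * (Uᵀ * V) i j := by
    intro i j
    have := entry id i j
    rwa [cfc_id_of_isHermitian hA, cfc_id_of_isHermitian hB] at this
  have hDn : ‖D‖ ≤ ‖A - B‖ := norm_conj_le U V _ hU hV
  -- Each weight `ψ (a i)` or `ψ (b j)` depends on one index only, so the other is summed out; a
  -- single row or column is bounded by the spectral norm, with no dimensional factor.
  have hcol : ∀ j, ∑ i, D i j ^ 2 ≤ ‖A - B‖ ^ 2 := fun j =>
    (sum_sq_apply_le_norm_sq D j).trans (pow_le_pow_left₀ (norm_nonneg _) hDn 2)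
  have hrow : ∀ i, ∑ j, D i j ^ 2 ≤ ‖A - B‖ ^ 2 := fun i => by
    refine (sum_sq_apply_le_norm_sq Dᵀ i).trans (pow_le_pow_left₀ (norm_nonneg _) ?_ 2)
    rwa [← conjTranspose_eq_transpose_of_trivial, l2_opNorm_conjTranspose]
  rw [frob, trace_cfc_of_eq_conj hU (hUA ψ), trace_cfc_of_eq_conj hV (hVB ψ)]
  calc ∑ i, ∑ j, ((Uᵀ * (cfc φ A - cfc φ B) * V) i j) ^ 2
      ≤ ∑ i, ∑ j, (ψ (a i) * D i j ^ 2 + ψ (b j) * D i j ^ 2) := by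
        gcongr with i _ j _
        rw [entry, hDe, mul_pow, mul_pow]
        have := mul_le_mul_of_nonneg_right (h (a i) (b j)) (sq_nonneg ((Uᵀ * V) i j))
        linarith
    _ = ∑ i, ψ (a i) * ∑ j, D i j ^ 2 + ∑ j, ψ (b j) * ∑ i, D i j ^ 2 := by
        simp only [Finset.sum_add_distrib, Finset.mul_sum]
        congr 1
        rw [Finset.sum_comm]
    _ ≤ ∑ i, ψ (a i) * ‖A - B‖ ^ 2 + ∑ j, ψ (b j) * ‖A - B‖ ^ 2 := by
        gcongr with i _ j _
        · exact hψ _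
        · exact hrow i
        · exact hψ _
        · exact hcol j
    _ = _ := by rw [← Finset.sum_mul, ← Finset.sum_mul]; ring

/-- Jensen's inequality for trace functions. -/
lemma trace_cfc_sum_le {ι : Type*} [Fintype ι] {f : ℝ → ℝ} (hf : ConvexOn ℝ Set.univ f)
    {w : ι → ℝ} (hw : w ∈ stdSimplex ℝ ι) {A : ι → Matrix n n ℝ} (hA : ∀ k, (A k).IsHermitian) :
    (cfc f (∑ k, w k • A k)).trace ≤ ∑ k, w k * (cfc f (A k)).trace := by
  have hS : (∑ k, w k • A k).IsHermitian := by
    simp only [IsHermitian, conjTranspose_sum, conjTranspose_smul, star_trivial, (hA _).eq]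
  obtain ⟨U, a, hU, hU', hUA⟩ := hS.exists_cfc_eq_conj
  -- Peierls' inequality: the squared entries of the orthogonal matrix `Uᵀ * V` are doubly
  -- stochastic, so the diagonal of `A k` in any orthonormal basis averages its eigenvalues.
  have single : ∀ k, ∑ i, f ((Uᵀ * A k * U) i i) ≤ (cfc f (A k)).trace := by
    intro k
    obtain ⟨V, b, hV, hV', hVA⟩ := (hA k).exists_cfc_eq_conj
    rw [trace_cfc_of_eq_conj hV (hVA f)]
    have hAk : A k = V * diagonal b * Vᵀ := by
      rw [← cfc_id_of_isHermitian (hA k)]; exact hVA id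
    have row : ∀ i, ∑ j, (Uᵀ * V) i j ^ 2 = 1 := by
      intro i
      have e : (Uᵀ * V) * (Uᵀ * V)ᵀ = 1 := by
        rw [transpose_mul, transpose_transpose, Matrix.mul_assoc, ← Matrix.mul_assoc V, hV',
          Matrix.one_mul, hU]
      have := congrFun (congrFun e i) i
      rw [mul_apply, one_apply_eq] at this
      simpa [pow_two] using this
    have col : ∀ j, ∑ i, (Uᵀ * V) i j ^ 2 = 1 := by
      intro j
      have e : (Uᵀ * V)ᵀ * (Uᵀ * V) = 1 := by
        rw [transpose_mul, transpose_transpose, Matrix.mul_assoc, ← Matrix.mul_assoc U, hU',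
          Matrix.one_mul, hV]
      have := congrFun (congrFun e j) j
      rw [mul_apply, one_apply_eq] at this
      simpa [pow_two] using this
    have diag_eq : ∀ i, (Uᵀ * A k * U) i i = ∑ j, (Uᵀ * V) i j ^ 2 • b j := by
      intro i
      have e : Uᵀ * A k * U = (Uᵀ * V) * diagonal b * (Uᵀ * V)ᵀ := by
        rw [hAk, transpose_mul, transpose_transpose]; simp only [Matrix.mul_assoc]
      rw [e, mul_apply]
      refine Finset.sum_congr rfl fun j _ => ?_
      rw [mul_diagonal, transpose_apply, smul_eq_mul]; ring
    calc ∑ i, f ((Uᵀ * A k * U) i i) ≤ ∑ i, ∑ j, (Uᵀ * V) i j ^ 2 * f (b j) := by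
          gcongr with i _
          rw [diag_eq]
          exact hf.map_sum_le (fun j _ => sq_nonneg _) (row i) (fun j _ => Set.mem_univ _)
      _ = ∑ j, (∑ i, (Uᵀ * V) i j ^ 2) * f (b j) := by
          rw [Finset.sum_comm]; simp only [Finset.sum_mul]
      _ = ∑ j, f (b j) := by simp [col]
  have ha : ∀ i, a i = ∑ k, w k • (Uᵀ * A k * U) i i := by
    intro i
    have e : Uᵀ * (∑ k, w k • A k) * U = diagonal a := by
      have := hUA id
      rw [cfc_id_of_isHermitian hS] at this
      rw [this, ← Matrix.mul_assoc, ← Matrix.mul_assoc, hU, Matrix.one_mul, Matrix.mul_assoc, hU,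
        Matrix.mul_one]
      rfl
    have := congrFun (congrFun e i) i
    rw [diagonal_apply_eq] at this
    rw [← this, Matrix.mul_sum, Matrix.sum_mul, sum_apply]
    simp
  rw [trace_cfc_of_eq_conj hU (hUA f)]
  calc ∑ i, f (a i) ≤ ∑ i, ∑ k, w k * f ((Uᵀ * A k * U) i i) := by
        gcongr with i _
        rw [ha]
        exact hf.map_sum_le (fun k _ => hw.1 k) hw.2 (fun k _ => Set.mem_univ _)
    _ = ∑ k, w k * ∑ i, f ((Uᵀ * A k * U) i i) := by
        rw [Finset.sum_comm]; simp only [Finset.mul_sum]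
    _ ≤ _ := by
        gcongr with k _
        · exact hw.1 k
        · exact single k

/-- Some eigenvalue has modulus at least `t`. As `cosh` is even and positive, one trace covers both
ends of the spectrum. -/
lemma cosh_le_trace_cfc_cosh {A : Matrix n n ℝ} (hA : A.IsHermitian) {t : ℝ} (ht : 0 < t) (c : ℝ)
    (h : t ≤ ‖A‖) : Real.cosh (c * t) ≤ (cfc (fun x => Real.cosh (c * x)) A).trace := by
  obtain ⟨U, a, hU, hU', hUA⟩ := hA.exists_cfc_eq_conj
  rw [trace_cfc_of_eq_conj (φ := fun x => Real.cosh (c * x)) hU (hUA _)]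
  have hAn : t ≤ ‖a‖ := by
    refine h.trans ?_
    have := norm_conj_le Uᵀ Uᵀ (diagonal a) (by simpa using hU') (by simpa using hU')
    rw [transpose_transpose, l2_opNorm_diagonal] at this
    have e := hUA id
    rw [cfc_id_of_isHermitian hA] at e
    rw [e]
    exact this
  obtain ⟨i, hi⟩ : ∃ i, t ≤ ‖a i‖ := by
    by_contra! hlt
    exact absurd ((pi_norm_lt_iff ht).2 hlt) hAn.not_gt
  calc Real.cosh (c * t) ≤ Real.cosh (c * a i) := by
        rw [Real.cosh_le_cosh, abs_mul, abs_mul, abs_of_pos ht]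
        exact mul_le_mul_of_nonneg_left hi (abs_nonneg c)
    _ ≤ _ := Finset.single_le_sum (f := fun i => Real.cosh (c * a i))
        (fun i _ => (Real.cosh_pos _).le) (Finset.mem_univ i)

end Matrix

/-! ### Exponential moments from the Poincaré inequality. -/

namespace MatrixPoincare

open Matrix

variable {Ω : Type*} [Fintype Ω] {d : ℕ} {P : Matrix Ω Ω ℝ} {p : Ω → ℝ} {lam : ℝ}

lemma trace_expect (p : Ω → ℝ) (f : Ω → Matrix (Fin d) (Fin d) ℝ) :
    (expect p f).trace = ∑ x, p x * (f x).trace := by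
  simp [expect, trace_sum, trace_smul]

lemma trace_dirichlet (f : Ω → Matrix (Fin d) (Fin d) ℝ) :
    (dirichlet P p f).trace = ∑ x, ∑ y, p x * P x y * ((f x - f y) ^ 2).trace := by
  simp [dirichlet, trace_sum, trace_smul]

lemma isSymm_expect {f : Ω → Matrix (Fin d) (Fin d) ℝ} (hf : ∀ x, (f x).IsSymm) :
    (expect p f).IsSymm := by
  simp only [IsSymm, expect, transpose_sum, transpose_smul, (hf _).eq]

lemma Poincare.trace_le (h : Poincare d P p lam) {f : Ω → Matrix (Fin d) (Fin d) ℝ}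
    (hf : ∀ x, (f x).IsSymm) :
    lam * ((∑ x, p x * (f x ^ 2).trace) - (expect p f ^ 2).trace) ≤
      ∑ x, ∑ y, p x * P x y * ((f x - f y) ^ 2).trace := by
  have := (h f hf).trace_nonneg
  rw [trace_sub, trace_smul, variance, trace_sub, trace_expect, trace_dirichlet,
    smul_eq_mul] at this
  linarith

lemma trace_sq_expect_le (hp : p ∈ stdSimplex ℝ Ω) {f : Ω → Matrix (Fin d) (Fin d) ℝ}
    (hf : ∀ x, (f x).IsSymm) : (expect p f ^ 2).trace ≤ ∑ x, p x * (f x ^ 2).trace := by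
  have h2 : ∀ A : Matrix (Fin d) (Fin d) ℝ, A.IsSymm →
      (A ^ 2).trace = ∑ i, ∑ j, A i j ^ 2 := by
    intro A hA
    rw [← trace_transpose_mul_self_eq_sum, hA.eq, pow_two]
  have hconv : ConvexOn ℝ Set.univ (fun x : ℝ => x ^ 2) := even_two.convexOn_pow
  rw [h2 _ (isSymm_expect hf)]
  calc ∑ i, ∑ j, expect p f i j ^ 2 ≤ ∑ i, ∑ j, ∑ x, p x * f x i j ^ 2 := by
        gcongr with i _ j _
        have := hconv.map_sum_le (t := Finset.univ) (w := p) (p := fun x => f x i j)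
          (fun x _ => hp.1 x) hp.2 (fun x _ => Set.mem_univ _)
        simpa [expect, Matrix.sum_apply] using this
    _ = ∑ x, ∑ i, ∑ j, p x * f x i j ^ 2 := by
        symm
        rw [Finset.sum_comm]
        exact Finset.sum_congr rfl fun i _ => Finset.sum_comm
    _ = _ := by simp only [h2 _ (hf _), Finset.mul_sum]

lemma norm_sub_le_maxStep (F : Ω → Matrix (Fin d) (Fin d) ℝ) {x y : Ω} (h : 0 < P x y) :
    ‖F x - F y‖ ≤ maxStep P F :=
  le_ciSup (f := fun e : {e : Ω × Ω // 0 < P e.1 e.2} => ‖F e.1.1 - F e.1.2‖)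
    (Set.finite_range _).bddAbove ⟨(x, y), h⟩

lemma IsReversible.sum_mul_apply [DecidableEq Ω] (h : IsReversible P p) (y : Ω) :
    ∑ x, p x * P x y = p y := by
  simp_rw [h.detailed_balance _ y, ← Finset.mul_sum,
    Matrix.sum_row_of_mem_rowStochastic h.stochastic, mul_one]

/-- A Poincaré inequality for antisymmetric functions on the product space. -/
lemma Poincare.sum_trace_sq_le_of_antisymm (h : Poincare d P p lam)
    (hp : p ∈ stdSimplex ℝ Ω) (hP : ∀ x y, 0 ≤ P x y)
    {H : Ω → Ω → Matrix (Fin d) (Fin d) ℝ} (hs : ∀ x z, (H x z).IsSymm)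
    (ha : ∀ x z, H z x = -H x z) :
    lam * ∑ z, p z * ∑ x, p x * (H x z ^ 2).trace ≤
      2 * ∑ z, p z * ∑ x, ∑ y, p x * P x y * ((H x z - H y z) ^ 2).trace := by
  set k : Ω → Matrix (Fin d) (Fin d) ℝ := fun z => expect p fun x => H x z with hk
  have hks : ∀ z, (k z).IsSymm := fun z => isSymm_expect fun x => hs x z
  have hk0 : expect p k = 0 := by
    have e : expect p k = -expect p k := by
      calc expect p k = ∑ z, ∑ x, (p z * p x) • H x z := by
            simp [hk, expect, Finset.smul_sum, smul_smul]
        _ = ∑ x, ∑ z, (p z * p x) • H x z := Finset.sum_comm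
        _ = -expect p k := by
            simp only [hk, expect, Finset.smul_sum, smul_smul, ← Finset.sum_neg_distrib]
            refine Finset.sum_congr rfl fun x _ => Finset.sum_congr rfl fun z _ => ?_
            rw [ha z x, smul_neg, mul_comm]
    ext i j
    have := congrFun (congrFun e i) j
    rw [neg_apply] at this
    rw [Matrix.zero_apply]
    linarith
  have h1 : ∀ z, lam * ∑ x, p x * (H x z ^ 2).trace ≤
      lam * (k z ^ 2).trace + ∑ x, ∑ y, p x * P x y * ((H x z - H y z) ^ 2).trace := by
    intro z
    have := h.trace_le (f := fun x => H x z) (fun x => hs x z)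
    simp only [hk] at *
    linarith
  have h2 : lam * ∑ z, p z * (k z ^ 2).trace ≤
      ∑ x, ∑ y, p x * P x y * ((k x - k y) ^ 2).trace := by
    have := h.trace_le hks
    rw [hk0] at this
    simpa using this
  -- Jensen averages over the first variable of `H`; antisymmetry turns differences in the second
  -- variable into differences in the first.
  have h3 : ∀ x y, ((k x - k y) ^ 2).trace ≤ ∑ z, p z * ((H x z - H y z) ^ 2).trace := by
    intro x y
    have e : k x - k y = expect p fun z => H z x - H z y := by
      simp [hk, expect, smul_sub]
    rw [e]
    refine (trace_sq_expect_le hp fun z => (hs z x).sub (hs z y)).trans_eq ?_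
    refine Finset.sum_congr rfl fun z _ => ?_
    rw [ha x z, ha y z, ← neg_sub', neg_sq]
  have h4 : ∑ x, ∑ y, p x * P x y * ((k x - k y) ^ 2).trace ≤
      ∑ z, p z * ∑ x, ∑ y, p x * P x y * ((H x z - H y z) ^ 2).trace := by
    calc _ ≤ ∑ x, ∑ y, p x * P x y * ∑ z, p z * ((H x z - H y z) ^ 2).trace := by
          gcongr with x _ y _
          · exact mul_nonneg (hp.1 x) (hP x y)
          · exact h3 x y
      _ = ∑ x, ∑ z, ∑ y, p z * (p x * P x y * ((H x z - H y z) ^ 2).trace) := by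
          refine Finset.sum_congr rfl fun x _ => ?_
          rw [Finset.sum_comm]
          refine Finset.sum_congr rfl fun y _ => ?_
          rw [Finset.mul_sum]
          exact Finset.sum_congr rfl fun z _ => by ring
      _ = _ := by
          rw [Finset.sum_comm]; simp only [Finset.mul_sum]
  calc lam * ∑ z, p z * ∑ x, p x * (H x z ^ 2).trace
      = ∑ z, p z * (lam * ∑ x, p x * (H x z ^ 2).trace) := by
        rw [Finset.mul_sum]; exact Finset.sum_congr rfl fun z _ => by ring
    _ ≤ ∑ z, p z * (lam * (k z ^ 2).trace +
          ∑ x, ∑ y, p x * P x y * ((H x z - H y z) ^ 2).trace) := by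
        gcongr with z _
        · exact hp.1 z
        · exact h1 z
    _ = lam * ∑ z, p z * (k z ^ 2).trace +
          ∑ z, p z * ∑ x, ∑ y, p x * P x y * ((H x z - H y z) ^ 2).trace := by
        rw [Finset.mul_sum, ← Finset.sum_add_distrib]
        exact Finset.sum_congr rfl fun z _ => by ring
    _ ≤ _ := by linarith

/-- The mean value inequality on an edge gives equal terms for its two ends; stochasticity and
stationarity make both sum to the same `p`-average. -/
lemma sum_trace_sq_cfc_sinh_sub_le [DecidableEq Ω] (hP : IsReversible P p)
    {G : Ω → Matrix (Fin d) (Fin d) ℝ} (hG : ∀ x, (G x).IsHermitian) {v : ℝ}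
    (hv : ∀ x y, 0 < P x y → ‖G x - G y‖ ≤ v) (c : ℝ) :
    ∑ x, ∑ y, p x * P x y * ((cfc (fun a => Real.sinh (c * a)) (G x)
        - cfc (fun a => Real.sinh (c * a)) (G y)) ^ 2).trace ≤
      c ^ 2 * v ^ 2 * ∑ x, p x * (cfc (fun a => Real.cosh (c * a) ^ 2) (G x)).trace := by
  set ψ : ℝ → ℝ := fun a => Real.cosh (c * a) ^ 2
  have hψ : ∀ A : Matrix (Fin d) (Fin d) ℝ,
      (cfc (fun a => c ^ 2 / 2 * ψ a) A).trace = c ^ 2 / 2 * (cfc ψ A).trace := by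
    intro A
    rw [cfc_const_mul _ _ _ (continuousOn_spectrum _ _), trace_smul, smul_eq_mul]
  set T : Ω → ℝ := fun x => (cfc ψ (G x)).trace
  have hP0 : ∀ x y, 0 ≤ P x y := fun x y => nonneg_of_mem_rowStochastic hP.stochastic
  have key : ∀ x y, p x * P x y * ((cfc (fun a => Real.sinh (c * a)) (G x)
      - cfc (fun a => Real.sinh (c * a)) (G y)) ^ 2).trace ≤
      c ^ 2 * v ^ 2 / 2 * (p x * P x y * T x + p x * P x y * T y) := by
    intro x y
    rcases (hP0 x y).eq_or_lt with h0 | h0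
    · simp [← h0]
    have h1 := trace_sq_cfc_sub_le (hG x) (hG y) (fun a => Real.sinh (c * a))
      (fun a => c ^ 2 / 2 * ψ a) (fun a b => by
        have := Real.sinh_sub_sinh_sq_le (c * a) (c * b)
        simp only [ψ]
        linarith) (fun a => by positivity)
    rw [hψ, hψ] at h1
    have hT : 0 ≤ c ^ 2 / 2 * T x + c ^ 2 / 2 * T y := by
      have hTn : ∀ z, 0 ≤ T z := by
        intro z
        obtain ⟨U, a, hU, -, hUA⟩ := (hG z).exists_cfc_eq_conj
        simp only [T, trace_cfc_of_eq_conj hU (hUA ψ)]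
        positivity
      have := hTn x
      have := hTn y
      positivity
    have h2 := h1.trans (mul_le_mul_of_nonneg_right
      (pow_le_pow_left₀ (norm_nonneg _) (hv x y h0) 2) hT)
    have h3 := mul_le_mul_of_nonneg_left h2 (mul_nonneg (hP.distribution.1 x) h0.le)
    linarith
  calc _ ≤ ∑ x, ∑ y, c ^ 2 * v ^ 2 / 2 * (p x * P x y * T x + p x * P x y * T y) :=
        Finset.sum_le_sum fun x _ => Finset.sum_le_sum fun y _ => key x y
    _ = c ^ 2 * v ^ 2 / 2 * (∑ x, ∑ y, p x * P x y * T x + ∑ x, ∑ y, p x * P x y * T y) := by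
        simp only [← Finset.mul_sum, ← Finset.sum_add_distrib]
    _ = c ^ 2 * v ^ 2 / 2 * (∑ x, p x * T x + ∑ x, p x * T x) := by
        congr 2
        · refine Finset.sum_congr rfl fun x _ => ?_
          rw [← Finset.sum_mul, ← Finset.mul_sum, sum_row_of_mem_rowStochastic hP.stochastic,
            mul_one]
        · rw [Finset.sum_comm]
          refine Finset.sum_congr rfl fun y _ => ?_
          rw [← Finset.sum_mul, hP.sum_mul_apply]
    _ = _ := by ring

/-- The symmetrized exponential moment bound. -/
lemma Poincare.sum_trace_cfc_cosh_le [DecidableEq Ω] (h : Poincare d P p lam) (hlam : 0 < lam)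
    (hP : IsReversible P p) {F : Ω → Matrix (Fin d) (Fin d) ℝ} (hF : ∀ x, (F x).IsSymm)
    {c s : ℝ} (hs : s = 2 * c ^ 2 * maxStep P F ^ 2 / lam) (hs1 : s < 1) :
    ∑ z, p z * ∑ x, p x * (cfc (fun a => Real.cosh (2 * c * a)) (F x - F z)).trace ≤
      d * ((1 + s) / (1 - s)) := by
  have hG : ∀ x z, (F x - F z).IsHermitian := fun x z => by
    rw [IsHermitian, conjTranspose_eq_transpose_of_trivial]; exact (hF x).sub (hF z)
  have hsymm : ∀ (φ : ℝ → ℝ) (A : Matrix (Fin d) (Fin d) ℝ), (cfc φ A).IsSymm := fun φ A => by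
    rw [IsSymm, ← conjTranspose_eq_transpose_of_trivial]; exact isHermitian_cfc φ A
  set φ : ℝ → ℝ := fun a => Real.sinh (c * a) with hφ
  set H : Ω → Ω → Matrix (Fin d) (Fin d) ℝ := fun x z => cfc φ (F x - F z) with hH
  have hanti : ∀ x z, H z x = -H x z := by
    intro x z
    simp only [hH]
    rw [← neg_sub (F x) (F z)]
    exact cfc_neg_of_odd (fun a => by simp [hφ]) (hG x z)
  set S := ∑ z, p z * ∑ x, p x * (H x z ^ 2).trace with hS
  have hsq : ∀ A : Matrix (Fin d) (Fin d) ℝ, A.IsHermitian →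
      (cfc (fun a => Real.cosh (c * a) ^ 2) A).trace = d + (cfc φ A ^ 2).trace ∧
      (cfc (fun a => Real.cosh (2 * c * a)) A).trace = d + 2 * (cfc φ A ^ 2).trace := by
    intro A hA
    obtain ⟨U, a, hU, -, hUA⟩ := hA.exists_cfc_eq_conj
    rw [← cfc_pow _ _ _ (continuousOn_spectrum _ _)]
    rw [trace_cfc_of_eq_conj hU (hUA (fun a => Real.cosh (c * a) ^ 2)),
      trace_cfc_of_eq_conj hU (hUA (fun a => Real.cosh (2 * c * a))),
      trace_cfc_of_eq_conj hU (hUA (fun a => φ a ^ 2))]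
    constructor
    · simp [hφ, Real.cosh_sq, Finset.sum_add_distrib, add_comm]
    · have e : ∀ x, Real.cosh (2 * c * x) = 1 + 2 * Real.sinh (c * x) ^ 2 := fun x => by
        rw [mul_assoc, Real.cosh_two_mul, Real.cosh_sq]; ring
      simp [hφ, e, Finset.sum_add_distrib, Finset.mul_sum]
  have hp1 := hP.distribution.2
  have hsum : ∀ κ : ℝ, ∑ z, p z * ∑ x, p x * (d + κ * (H x z ^ 2).trace) = d + κ * S := by
    intro κ
    simp only [mul_add, Finset.sum_add_distrib, ← Finset.sum_mul, hp1, one_mul, hS, Finset.mul_sum]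
    congr 1
    refine Finset.sum_congr rfl fun z _ => Finset.sum_congr rfl fun x _ => by ring
  have h1 : lam * S ≤ 2 * (c ^ 2 * maxStep P F ^ 2 * (d + S)) := by
    refine (h.sum_trace_sq_le_of_antisymm hP.distribution
      (fun x y => nonneg_of_mem_rowStochastic hP.stochastic) (fun x z => hsymm _ _) hanti).trans ?_
    gcongr
    have := hsum 1
    rw [one_mul] at this
    rw [← this, Finset.mul_sum]
    refine Finset.sum_le_sum fun z _ => ?_
    have h2 := sum_trace_sq_cfc_sinh_sub_le hP (fun x => hG x z) (v := maxStep P F)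
      (fun x y hxy => by rw [sub_sub_sub_cancel_right]; exact norm_sub_le_maxStep F hxy) c
    refine (mul_le_mul_of_nonneg_left h2 (hP.distribution.1 z)).trans_eq ?_
    simp only [(hsq _ (hG _ z)).1, one_mul, hH, hφ]
    ring
  -- The self-bounding inequality, to be solved for `S` using `s < 1`.
  have h2 : S ≤ s * (d + S) := by
    rw [hs, div_mul_eq_mul_div, le_div_iff₀ hlam]
    linarith
  calc _ = d + 2 * S := by
        rw [← hsum 2]; simp only [(hsq _ (hG _ _)).2, hH]
    _ ≤ _ := by
        rw [← mul_div_assoc, le_div_iff₀ (by linarith)]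
        nlinarith

/-- The bound on the deviation probability for an arbitrary exponent. -/
lemma Poincare.deviationProb_mul_cosh_le [DecidableEq Ω] (h : Poincare d P p lam) (hlam : 0 < lam)
    (hP : IsReversible P p) {F : Ω → Matrix (Fin d) (Fin d) ℝ} (hF : ∀ x, (F x).IsSymm)
    {c s t : ℝ} (hs : s = 2 * c ^ 2 * maxStep P F ^ 2 / lam) (hs1 : s < 1) (ht : 0 < t) :
    deviationProb p F t * Real.cosh (2 * c * t) ≤ d * ((1 + s) / (1 - s)) := by
  refine le_trans ?_ (h.sum_trace_cfc_cosh_le hlam hP hF hs hs1)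
  set f : ℝ → ℝ := fun a => Real.cosh (2 * c * a) with hf
  have hp := hP.distribution
  have hherm : ∀ {A : Matrix (Fin d) (Fin d) ℝ}, A.IsSymm → A.IsHermitian := fun {A} hA => by
    rwa [IsHermitian, conjTranspose_eq_transpose_of_trivial]
  have hdev : ∀ x, (F x - expect p F).IsHermitian := fun x =>
    hherm ((hF x).sub (isSymm_expect hF))
  have hconv : ConvexOn ℝ Set.univ f := by
    have := Real.convexOn_cosh.comp_linearMap ((2 * c) • LinearMap.id : ℝ →ₗ[ℝ] ℝ)
    rw [Set.preimage_univ] at this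
    exact this
  have hnn : ∀ x, 0 ≤ (cfc f (F x - expect p F)).trace := by
    intro x
    obtain ⟨U, a, hU, -, hUA⟩ := (hdev x).exists_cfc_eq_conj
    rw [trace_cfc_of_eq_conj hU (hUA f)]
    exact Finset.sum_nonneg fun i _ => (Real.cosh_pos _).le
  have hjensen : ∀ x, (cfc f (F x - expect p F)).trace ≤
      ∑ z, p z * (cfc f (F x - F z)).trace := by
    intro x
    have e : F x - expect p F = ∑ z, p z • (F x - F z) := by
      simp only [smul_sub, Finset.sum_sub_distrib, ← Finset.sum_smul, hp.2, one_smul, expect]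
    rw [e]
    exact trace_cfc_sum_le hconv hp fun z => hherm ((hF x).sub (hF z))
  calc deviationProb p F t * Real.cosh (2 * c * t)
      = ∑ x with t ≤ ‖F x - expect p F‖, p x * Real.cosh (2 * c * t) := by
        rw [deviationProb, Finset.sum_mul]
    _ ≤ ∑ x with t ≤ ‖F x - expect p F‖, p x * (cfc f (F x - expect p F)).trace := by
        refine Finset.sum_le_sum fun x hx => mul_le_mul_of_nonneg_left ?_ (hp.1 x)
        exact cosh_le_trace_cfc_cosh (hdev x) ht (2 * c) (Finset.mem_filter.1 hx).2
    _ ≤ ∑ x, p x * (cfc f (F x - expect p F)).trace :=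
        Finset.sum_le_sum_of_subset_of_nonneg (Finset.filter_subset _ _)
          fun x _ _ => mul_nonneg (hp.1 x) (hnn x)
    _ ≤ ∑ x, p x * ∑ z, p z * (cfc f (F x - F z)).trace :=
        Finset.sum_le_sum fun x _ => mul_le_mul_of_nonneg_left (hjensen x) (hp.1 x)
    _ = ∑ z, p z * ∑ x, p x * (cfc f (F x - F z)).trace := by
        simp only [Finset.mul_sum]
        rw [Finset.sum_comm]
        refine Finset.sum_congr rfl fun z _ => Finset.sum_congr rfl fun x _ => by ring

lemma deviationProb_nonneg (hp : p ∈ stdSimplex ℝ Ω) (F : Ω → Matrix (Fin d) (Fin d) ℝ) (t : ℝ) :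
    0 ≤ deviationProb p F t :=
  Finset.sum_nonneg fun x _ => hp.1 x

end MatrixPoincare

/-! ### Choice of the exponent. -/

lemma one_add_div_one_sub_le_exp {s : ℝ} (hs1 : s < 1) :
    (1 + s) / (1 - s) ≤ Real.exp (2 * s / (1 - s)) := by
  have := Real.add_one_le_exp (2 * s / (1 - s))
  refine le_trans (le_of_eq ?_) this
  have : 1 - s ≠ 0 := by linarith
  field_simp
  ring

theorem theorem3 {Ω : Type*} [Fintype Ω] [DecidableEq Ω] {d : ℕ}
    (P : Matrix Ω Ω ℝ) (p : Ω → ℝ) (hP : MatrixPoincare.IsReversible P p)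
    (lam : ℝ) (hlam : 0 < lam) (hPoincare : MatrixPoincare.Poincare d P p lam)
    (F : Ω → Matrix (Fin d) (Fin d) ℝ) (hF : ∀ x, (F x).IsSymm)
    (t : ℝ) (ht : 0 < t) :
    (0 < MatrixPoincare.maxStep P F →
      MatrixPoincare.deviationProb p F t ≤
        2 * (d : ℝ) * Real.exp (-(t ^ 2 / (4 * (MatrixPoincare.maxStep P F ^ 2 / lam
          + t * MatrixPoincare.maxStep P F / Real.sqrt lam))))) ∧
    (MatrixPoincare.maxStep P F = 0 → MatrixPoincare.deviationProb p F t = 0) := by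
  have hdev0 := MatrixPoincare.deviationProb_nonneg hP.distribution F t
  constructor
  · intro hv
    set v := MatrixPoincare.maxStep P F
    set r := Real.sqrt lam
    have hr : 0 < r := Real.sqrt_pos.2 hlam
    have hr2 : lam = r ^ 2 := (Real.sq_sqrt hlam.le).symm
    set σ := v / r with hσ
    have hσ0 : 0 < σ := div_pos hv hr
    set u := t / σ with hu
    have hu0 : 0 < u := div_pos ht hσ0
    have htu : t = u * σ := by rw [hu]; field_simp
    -- With `u` the deviation in units of `σ`, the target exponent is `u² / (4 (1 + u))`. The `c`
    -- below makes `2 c t` twice that; half of it pays for `(1 + s) / (1 - s)`. The prefactor 2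
    -- comes from `cosh x ≥ exp x / 2`.
    set s := u ^ 2 / (8 * (1 + u) ^ 2) with hs
    have hs0 : 0 ≤ s := by positivity
    have hs8 : s ≤ 1 / 8 := by
      rw [hs, div_le_div_iff₀ (by positivity) (by norm_num)]
      nlinarith
    set c := u / (4 * (1 + u) * σ) with hc
    have hsc : s = 2 * c ^ 2 * v ^ 2 / lam := by
      rw [hs, hc, hσ, hr2]
      field_simp
      ring
    have hmain := hPoincare.deviationProb_mul_cosh_le hlam hP hF hsc (by linarith) ht
    have hexp : Real.exp (2 * c * t) / 2 ≤ Real.cosh (2 * c * t) := by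
      rw [Real.cosh_eq]
      linarith [Real.exp_pos (-(2 * c * t))]
    have hE : t ^ 2 / (4 * (v ^ 2 / lam + t * v / r)) = u ^ 2 / (4 * (1 + u)) := by
      have e1 : v ^ 2 / lam = σ ^ 2 := by rw [hσ, hr2, div_pow]
      have e2 : t * v / r = u * σ ^ 2 := by rw [mul_div_assoc, ← hσ, htu]; ring
      rw [e1, e2, htu]
      field_simp
    have hct : 2 * c * t = u ^ 2 / (2 * (1 + u)) := by
      rw [hc, htu]
      field_simp
      ring
    have hexpo : 2 * s / (1 - s) ≤ u ^ 2 / (4 * (1 + u)) := by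
      have hs' : s * (8 * (1 + u) ^ 2) = u ^ 2 := by rw [hs]; field_simp
      rw [div_le_div_iff₀ (by linarith) (by positivity), ← hs']
      have h1 : 1 ≤ (1 + u) * (1 - s) := by nlinarith
      have := mul_le_mul_of_nonneg_left h1 (by positivity : 0 ≤ 8 * s * (1 + u))
      nlinarith
    rw [hE]
    have h1 : MatrixPoincare.deviationProb p F t * (Real.exp (2 * c * t) / 2) ≤
        d * Real.exp (u ^ 2 / (4 * (1 + u))) :=
      (mul_le_mul_of_nonneg_left hexp hdev0).trans (hmain.trans
        (mul_le_mul_of_nonneg_left ((one_add_div_one_sub_le_exp (by linarith)).trans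
          (Real.exp_le_exp.2 hexpo)) (Nat.cast_nonneg d)))
    have h2 : Real.exp (2 * c * t) =
        Real.exp (u ^ 2 / (4 * (1 + u))) * Real.exp (u ^ 2 / (4 * (1 + u))) := by
      rw [← Real.exp_add, hct]
      congr 1
      field_simp
      ring
    rw [Real.exp_neg, ← div_eq_mul_inv, le_div_iff₀ (Real.exp_pos _)]
    rw [h2] at h1
    refine le_of_mul_le_mul_right ?_ (Real.exp_pos (u ^ 2 / (4 * (1 + u))))
    linarith
  · intro hv
    refine le_antisymm ?_ hdev0
    by_contra! hpos
    -- When the maximal step is 0, `s = 0` for every `c`, so the probability times `cosh (2 c t)` is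
    -- at most `d` however large `c` is.
    obtain ⟨K, hK⟩ := exists_gt ((d : ℝ) / MatrixPoincare.deviationProb p F t)
    have hK0 : 0 < K := lt_of_le_of_lt (by positivity) hK
    have hmain := hPoincare.deviationProb_mul_cosh_le (c := K / t) (s := 0) hlam hP hF
      (by simp [hv]) one_pos ht
    have h1 : K ≤ Real.cosh (2 * (K / t) * t) := by
      have e : 2 * (K / t) * t = 2 * K := by field_simp
      rw [e, Real.cosh_eq]
      linarith [Real.add_one_le_exp (2 * K), Real.exp_pos (-(2 * K))]
    rw [div_lt_iff₀ hpos] at hK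
    have h2 := mul_le_mul_of_nonneg_left h1 hpos.le
    norm_num at hmain
    linarith
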